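/- **Theorem ($L_2$ consistency of honest CART under a constant regression function).** *Model.* Let $\mathcal D=\{(y_i,\mathbf x_i):1\le i\le n\}$ be a random (i.i.d.) sample with $y_i=\mu(\mathbf x_i)+\varepsilon_i$, where $\mathbf x_i$ takes values in $\mathcal X\subseteq\mathbb R^p$ and has law $P_X$; $\mu(\mathbf x)=c$ for all $\mathbf x\in\mathcal X$, for a constant $c\in\mathbb R$; $\mathbf x_i$ and $\varepsilon_i$ are independent; the coordinates $x_{i1},\dots,x_{ip}$ are independent with continuous (atomless) laws; $\mathbb E[\varepsilon_i]=0$ (hence $\mathbb E[\varepsilon_i\mid\mathbf x_i]=0$), $\sigma^2=\mathbb E[\varepsilon_i^2]>0$, and for some $\alpha>0$, $\mathbb E[\exp(\lambda\varepsilon_i)]<\infty$ for all $|\lambda|<1/\alpha$. *CART trees.* Given a data set $\mathcal D_{\mathsf T}$, a tree is grown from the root node $\mathbb R^p$ by recursive splitting: a node $\mathsf t$ is split into $\mathsf t\cap\{x_j\le\varsigma\}$ and $\mathsf t\cap\{x_j>\varsigma\}$, where $(j,\varsigma)$, together with some $\beta_L,\beta_R\in\mathbb R$, minimizes $$\sum_{\mathbf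 x_i\in\mathsf t}\bigl(y_i-\beta_L\mathbf 1(x_{ij}\le\varsigma)-\beta_R\mathbf 1(x_{ij}>\varsigma)\bigr)^2$$ over all $1\le j\le p$ and $\beta_L,\beta_R,\varsigma\in\mathbb R$. A depth-$K$ (possibly non-maximal) tree $\mathsf T(\mathcal D_{\mathsf T})$ is any tree so obtained with at most $K$ levels of splits; the stopping rule and the choice among minimizers are any functions of $\mathcal D_{\mathsf T}$ for which the relation "$\mathbf x$ and $\mathbf z$ lie in the same terminal node of $\mathsf T(\mathcal D_{\mathsf T})$" is jointly measurable in $(\mathcal D_{\mathsf T},\mathbf x,\mathbf z)$. *Honest estimator.* The sample is divided into two disjoint parts $\mathcal D_{\mathsf T}$ and $\mathcal D_\mu$ of sizes $n_{\mathsf T}$ and $n_\mu$, with $n_{\mathsf T}+n_\mu=n$ and $\rho^{-1}\le n_{\mathsf T}/n_\mu\le\rho$ for some fixed $\rho\ge 1$. The estimate $\hat\mu^{\mathtt{HON}}(\mathbf x)$ is the average of the responses of those observations of $\mathcal D_\mu$ whose covariates lie in the terminal node of $\mathsf T(\mathcal D_{\mathsf T})$ containing $\mathbf x$, and $0$ if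 there are none. *Conclusions.* (i) There is a constant $C>0$ depending only on $\sigma^2$ and $\rho$, and for every $c$ an integer $n_0$ depending only on $c,\sigma^2,\rho$, such that for all $n\ge n_0$ $$\mathbb E\Bigl[\int_{\mathcal X}\bigl(\hat\mu^{\mathtt{HON}}(\mathbf x)-\mu(\mathbf x)\bigr)^2\,dP_X(\mathbf x)\Bigr]\le C\,\frac{2^K\log(n)^5}{n}.$$ The same inequality holds for every $n\ge 2$ with a constant $C>0$ depending only on $\sigma^2$, $\rho$ and $c$. (ii) There is a constant $C'>0$ depending only on $\rho$ and the law of $\varepsilon_i$ such that $$\limsup_{n\to\infty}\ \mathbb P\Bigl(\int_{\mathcal X}\bigl(\hat\mu^{\mathtt{HON}}(\mathbf x)-\mu(\mathbf x)\bigr)^2\,dP_X(\mathbf x)\ge C'\,\frac{2^K\log(n)^5}{n}\Bigr)=0 .$$ Here $n$ runs along any sequence of sample sizes tending to infinity; the value $c$ and the law of $\varepsilon_i$ are fixed, while $K$, $p$, $\mathcal X$, $P_X$, the division of the sample and the tree-growing rule may vary along the sequence. -/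

import Mathlib

open MeasureTheory ProbabilityTheory Filter Topology
open scoped ENNReal

universe u

noncomputable section

/-- A data set of `m` observations `(xᵢ, yᵢ)` with covariates in `ℝ^p` and real responses. -/
abbrev Dataset (p m : ℕ) : Type := Fin m → (Fin p → ℝ) × ℝ

/-- Binary axis-aligned decision trees on `ℝ^p`. An internal node splits along coordinate `j` at
the point `s`: the left child receives `x j ≤ s`, the right child receives `x j > s`. -/
inductive DTree (p : ℕ) : Type
  | leaf : DTree p
  | node (j : Fin p) (s : ℝ) (L R : DTree p) : DTree p

namespace DTree

variable {p : ℕ}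

/-- The number of levels of splits. -/
def depth : DTree p → ℕ
  | leaf => 0
  | node _ _ L R => max L.depth R.depth + 1

/-- `T.cell x` is the terminal node (a region of `ℝ^p`) of the tree `T` that contains `x`. -/
def cell : DTree p → (Fin p → ℝ) → Set (Fin p → ℝ)
  | leaf, _ => Set.univ
  | node j s L R, x =>
      if x j ≤ s then {z | z j ≤ s} ∩ L.cell x else {z | s < z j} ∩ R.cell x

end DTree

/-- The local sample size: the number of observations with covariate in the region `t`. -/
def localSize {p m : ℕ} (D : Dataset p m) (t : Set (Fin p → ℝ)) : ℝ :=
  ∑ i, t.indicator (fun _ => (1 : ℝ)) (D i).1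

/-- The CART estimate at `x` from the tree `T` and the data `D`: the average of the responses
over the terminal node of `x`, and `0` if this node contains no observation. -/
def cartEstimate {p m : ℕ} (T : DTree p) (D : Dataset p m) (x : Fin p → ℝ) : ℝ :=
  if localSize D (T.cell x) = 0 then 0
  else (1 / localSize D (T.cell x)) * ∑ i, (T.cell x).indicator (fun _ => (D i).2) (D i).1

/-- The sum of squares over the observations in the node `t`, when `t` is split along
coordinate `j` at `s` and the two children have the outputs `bL` and `bR`. -/
def splitSSE {p m : ℕ} (D : Dataset p m) (t : Set (Fin p → ℝ))
    (j : Fin p) (bL bR s : ℝ) : ℝ :=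
  ∑ i, t.indicator
    (fun x => ((D i).2 - bL * (if x j ≤ s then 1 else 0) - bR * (if s < x j then 1 else 0)) ^ 2)
    (D i).1

/-- The split of the node `t` along coordinate `j` at `s` minimizes the sum of squares over all
split directions, split points and child outputs. -/
def IsOptimalSplit {p m : ℕ} (D : Dataset p m) (t : Set (Fin p → ℝ))
    (j : Fin p) (s : ℝ) : Prop :=
  ∃ bL bR : ℝ, ∀ (j' : Fin p) (bL' bR' s' : ℝ),
    splitSSE D t j bL bR s ≤ splitSSE D t j' bL' bR' s'

/-- The tree is obtained by recursively splitting the node `t`, every split being a minimizer of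
the sum of squares over the data in the node that is split. Splitting may stop at any node, so
the tree need not be maximal. -/
def IsCART {p m : ℕ} (D : Dataset p m) : Set (Fin p → ℝ) → DTree p → Prop
  | _, DTree.leaf => True
  | t, DTree.node j s L R =>
      IsOptimalSplit D t j s ∧
        IsCART D (t ∩ {x | x j ≤ s}) L ∧ IsCART D (t ∩ {x | s < x j}) R

/-- A (measurable) CART procedure of depth `K`: it assigns to every data set a CART tree grown
from the whole space, of depth at most `K`. The rules for stopping and for choosing among several
minimizers are arbitrary. -/
structure IsCARTProcedure {p m : ℕ} (K : ℕ) (T : Dataset p m → DTree p) : Prop where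
  isCART : ∀ D, IsCART D Set.univ (T D)
  depth_le : ∀ D, (T D).depth ≤ K
  measurable_cell :
    MeasurableSet {q : Dataset p m × (Fin p → ℝ) × (Fin p → ℝ) | q.2.2 ∈ (T q.1).cell q.2.1}

/-- `ν` is a centred error law with variance `σsq > 0` and exponential moments near `0`. -/
structure IsErrorLaw (ν : Measure ℝ) (σsq : ℝ) : Prop where
  isProbabilityMeasure : IsProbabilityMeasure ν
  mean_zero : ∫ e, e ∂ν = 0
  variance_eq : ∫ e, e ^ 2 ∂ν = σsq
  variance_pos : 0 < σsq
  exp_moment : ∃ α : ℝ, 0 < α ∧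
    ∀ l : ℝ, |l| < 1 / α → Integrable (fun e : ℝ => Real.exp (l * e)) ν

/-- The location regression model: `(xᵢ, yᵢ)`, `i = 1, …, n`, is a random sample with
`yᵢ = μ(xᵢ) + εᵢ`, where `xᵢ` takes values in `𝒳` and has law `PX`, `εᵢ` has law `ν`, the
regression function `μ` is equal to the constant `c` on `𝒳`, `xᵢ` is independent of `εᵢ`, and the
coordinates of `xᵢ` are independent with continuous (that is, atomless) laws. (For a centred law `ν`, independence of
`xᵢ` and `εᵢ` gives `E[εᵢ | xᵢ] = 0`.) -/
structure LocationModel {Ω : Type u} [MeasurableSpace Ω] (P : Measure Ω) {n p : ℕ}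
    (𝒳 : Set (Fin p → ℝ)) (μ : (Fin p → ℝ) → ℝ) (c : ℝ)
    (PX : Measure (Fin p → ℝ)) (ν : Measure ℝ)
    (X : Fin n → Ω → (Fin p → ℝ)) (ε Y : Fin n → Ω → ℝ) : Prop where
  measurableSet_support : MeasurableSet 𝒳
  measurable_X : ∀ i, Measurable (X i)
  measurable_ε : ∀ i, Measurable (ε i)
  mem_support : ∀ i ω, X i ω ∈ 𝒳
  outcome_eq : ∀ i ω, Y i ω = μ (X i ω) + ε i ω
  regression_const : ∀ x ∈ 𝒳, μ x = c
  indep_sample : iIndepFun (fun i ω => (X i ω, Y i ω)) P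
  law_X : ∀ i, P.map (X i) = PX
  law_ε : ∀ i, P.map (ε i) = ν
  indep_X_ε : ∀ i, IndepFun (X i) (ε i) P
  indep_coord : ∀ i, iIndepFun (fun (j : Fin p) ω => X i ω j) P
  continuous_coord : ∀ i (j : Fin p) (a : ℝ), P {ω | X i ω j = a} = 0

/-- An honest CART experiment with sample size `n`: a sample from the location model with constant
`c` and error law `ν`, a division of the sample into a tree sample of size `nT` and an estimation
sample of size `nμ` with `ρ⁻¹ ≤ nT / nμ ≤ ρ`, and a CART procedure of depth `K`. -/
structure HonestExperiment (ρ c : ℝ) (ν : Measure ℝ) (n : ℕ) where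
  Ω : Type u
  [mΩ : MeasurableSpace Ω]
  P : Measure Ω
  [isProb : IsProbabilityMeasure P]
  p : ℕ
  𝒳 : Set (Fin p → ℝ)
  μ : (Fin p → ℝ) → ℝ
  PX : Measure (Fin p → ℝ)
  X : Fin n → Ω → (Fin p → ℝ)
  ε : Fin n → Ω → ℝ
  Y : Fin n → Ω → ℝ
  model : LocationModel P 𝒳 μ c PX ν X ε Y
  nT : ℕ
  nμ : ℕ
  split : Fin nT ⊕ Fin nμ ≃ Fin n
  ratio_lower : ρ⁻¹ ≤ (nT : ℝ) / (nμ : ℝ)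
  ratio_upper : (nT : ℝ) / (nμ : ℝ) ≤ ρ
  K : ℕ
  tree : Dataset p nT → DTree p
  isCARTProcedure : IsCARTProcedure K tree

namespace HonestExperiment

attribute [instance] HonestExperiment.mΩ HonestExperiment.isProb

variable {ρ c : ℝ} {ν : Measure ℝ} {n : ℕ} (E : HonestExperiment.{u} ρ c ν n)

/-- The sample used to grow the tree. -/
def treeSample (ω : E.Ω) : Dataset E.p E.nT :=
  fun k => (E.X (E.split (Sum.inl k)) ω, E.Y (E.split (Sum.inl k)) ω)

/-- The sample used to compute the averages over the terminal nodes. -/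
def estSample (ω : E.Ω) : Dataset E.p E.nμ :=
  fun k => (E.X (E.split (Sum.inr k)) ω, E.Y (E.split (Sum.inr k)) ω)

/-- The honest CART estimator. -/
def honestEstimate (ω : E.Ω) (x : Fin E.p → ℝ) : ℝ :=
  cartEstimate (E.tree (E.treeSample ω)) (E.estSample ω) x

/-- The integrated squared error of the honest CART estimator with respect to the law of the
covariates, as an extended nonnegative number. -/
def integratedSqError (ω : E.Ω) : ℝ≥0∞ :=
  ∫⁻ x in E.𝒳, ENNReal.ofReal ((E.honestEstimate ω x - E.μ x) ^ 2) ∂E.PX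

/-- The rate `2^K log(n)^5 / n`. -/
def rate : ℝ := 2 ^ E.K * Real.log n ^ 5 / n

end HonestExperiment

end

/-! Honesty makes the tree independent of the estimation sample, so the tree may be fixed. If the
cell `A` of `x` holds `N` of the `m` estimation points, the conditional squared error is `σ²/N`, or
`c²` when `N = 0`; both are at most `(2σ² + c²)/(1 + N)`. Exchangeability gives `E[1/(1+N)] ≤
1/((m+1) Q(A))` (`lintegral_inv_one_add_card_le`), and integrating `1/Q(A)` over `x` counts the
cells of positive mass, at most `2^K` (`DTree.lintegral_inv_measure_cell_le`). The mean error is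
thus `O(2^K/n)`, with a constant depending on `c`, `σ²` and `ρ`. The factor `log(n)^5` absorbs this
constant, and Markov's inequality turns it into convergence of the probabilities to zero. -/

/-! ### Terminal nodes and their masses -/

lemma DTree.measurableSet_cell {p : ℕ} (T : DTree p) (x : Fin p → ℝ) :
    MeasurableSet (T.cell x) := by
  induction T with
  | leaf => exact MeasurableSet.univ
  | node j s L R hL hR =>
    unfold DTree.cell
    split_ifs
    · exact (measurableSet_le (measurable_pi_apply j) measurable_const).inter hL
    · exact (measurableSet_lt measurable_const (measurable_pi_apply j)).inter hR

/-- The reciprocals of the masses of the terminal nodes integrate to at most the number of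
terminal nodes. -/
lemma DTree.lintegral_inv_measure_cell_le {p : ℕ} (T : DTree p) (Q : Measure (Fin p → ℝ))
    {S : Set (Fin p → ℝ)} (hS : MeasurableSet S) :
    ∫⁻ x in S, (Q (S ∩ T.cell x))⁻¹ ∂Q ≤ 2 ^ T.depth := by
  -- `S` records the region cut out by the splits above: the cells of a subtree do not know their
  -- ancestors. A null region contributes zero although its inverse mass is infinite.
  induction T generalizing S with
  | leaf => simp [DTree.cell, DTree.depth, ENNReal.inv_mul_le_one]
  | node j s L R hL hR =>
    have hA : MeasurableSet {x : Fin p → ℝ | x j ≤ s} :=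
      measurableSet_le (measurable_pi_apply j) measurable_const
    have hB : MeasurableSet {x : Fin p → ℝ | s < x j} :=
      measurableSet_lt measurable_const (measurable_pi_apply j)
    have hAB : {x : Fin p → ℝ | x j ≤ s}ᶜ = {x | s < x j} := by ext; simp
    rw [← lintegral_inter_add_sdiff (μ := Q) _ S hA, Set.sdiff_eq, hAB]
    have h1 : ∫⁻ x in S ∩ {x | x j ≤ s}, (Q (S ∩ (DTree.node j s L R).cell x))⁻¹ ∂Q
        ≤ 2 ^ L.depth := by
      refine le_trans (le_of_eq ?_) (hL (hS.inter hA))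
      refine setLIntegral_congr_fun (hS.inter hA) fun x hx => ?_
      have : x j ≤ s := hx.2
      simp [DTree.cell, this, Set.inter_assoc]
    have h2 : ∫⁻ x in S ∩ {x | s < x j}, (Q (S ∩ (DTree.node j s L R).cell x))⁻¹ ∂Q
        ≤ 2 ^ R.depth := by
      refine le_trans (le_of_eq ?_) (hR (hS.inter hB))
      refine setLIntegral_congr_fun (hS.inter hB) fun x hx => ?_
      have : ¬ x j ≤ s := not_le.2 hx.2
      simp [DTree.cell, this, Set.inter_assoc]
    refine (add_le_add h1 h2).trans ?_
    rw [DTree.depth, pow_succ, mul_two]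
    exact add_le_add (pow_le_pow_right₀ (by norm_num) (le_max_left _ _))
      (pow_le_pow_right₀ (by norm_num) (le_max_right _ _))

/-! ### Inverse moments of cell counts -/

/-- For independent points with law `Q`, `E[1 / (1 + N)] ≤ 1 / ((m + 1) Q(A))`, where `N` counts
the points in `A` among `m`. -/
lemma lintegral_inv_one_add_card_le {α : Type*} [MeasurableSpace α] (Q : Measure α)
    [IsProbabilityMeasure Q] {A : Set α} (hA : MeasurableSet A) (m : ℕ) :
    ∫⁻ z, (1 + ∑ i, A.indicator (fun _ => (1 : ℝ≥0∞)) (z i))⁻¹ ∂(Measure.pi fun _ : Fin m => Q)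
      ≤ ((m + 1) * Q A)⁻¹ := by
  have hI : Measurable (A.indicator (fun _ => (1 : ℝ≥0∞))) := measurable_const.indicator hA
  have hN (k : ℕ) : Measurable fun z : Fin k → α =>
      ∑ i, A.indicator (fun _ => (1 : ℝ≥0∞)) (z i) :=
    Finset.measurable_sum _ fun i _ => hI.comp (measurable_pi_apply i)
  have hG : Measurable fun z : Fin m → α =>
      (1 + ∑ i, A.indicator (fun _ => (1 : ℝ≥0∞)) (z i))⁻¹ := ((hN m).const_add 1).inv
  set q := ∫⁻ z, (1 + ∑ i, A.indicator (fun _ => (1 : ℝ≥0∞)) (z i))⁻¹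
    ∂(Measure.pi fun _ : Fin m => Q)
  -- Add one point. If point `i` lies in `A`, the total count is one plus the count of the other `m`
  -- points, which are independent of it. Summing over `i` gives count times inverse count, at most
  -- one.
  have key (i : Fin (m + 1)) : ∫⁻ z, A.indicator (fun _ => (1 : ℝ≥0∞)) (z i) *
      (∑ k, A.indicator (fun _ => (1 : ℝ≥0∞)) (z k))⁻¹ ∂(Measure.pi fun _ : Fin (m + 1) => Q)
      = Q A * q := by
    have hmp : MeasurePreserving (fun z : Fin (m + 1) → α => (z i, fun k => z (i.succAbove k)))
        (Measure.pi fun _ => Q) (Q.prod (Measure.pi fun _ : Fin m => Q)) :=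
      measurePreserving_piFinSuccAbove (fun _ : Fin (m + 1) => Q) i
    have hF : Measurable fun y : α × (Fin m → α) => A.indicator (fun _ => (1 : ℝ≥0∞)) y.1 *
        (1 + ∑ k, A.indicator (fun _ => (1 : ℝ≥0∞)) (y.2 k))⁻¹ :=
      (hI.comp measurable_fst).mul (hG.comp measurable_snd)
    have h1 (z : Fin (m + 1) → α) : A.indicator (fun _ => (1 : ℝ≥0∞)) (z i) *
        (∑ k, A.indicator (fun _ => (1 : ℝ≥0∞)) (z k))⁻¹ =
        A.indicator (fun _ => (1 : ℝ≥0∞)) (z i) *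
          (1 + ∑ k, A.indicator (fun _ => (1 : ℝ≥0∞)) (z (i.succAbove k)))⁻¹ := by
      rw [Fin.sum_univ_succAbove _ i]
      by_cases h : z i ∈ A <;> simp [h]
    refine (lintegral_congr h1).trans ((hmp.lintegral_comp hF).trans ?_)
    rw [lintegral_prod_mul hI.aemeasurable hG.aemeasurable, lintegral_indicator_const hA, one_mul]
  rw [ENNReal.le_inv_iff_mul_le]
  calc q * ((m + 1) * Q A) = ∑ _i : Fin (m + 1), Q A * q := by
        simp; ring
    _ = ∫⁻ z, (∑ i, A.indicator (fun _ => (1 : ℝ≥0∞)) (z i)) *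
          (∑ k, A.indicator (fun _ => (1 : ℝ≥0∞)) (z k))⁻¹
          ∂(Measure.pi fun _ : Fin (m + 1) => Q) := by
        simp_rw [Finset.sum_mul]
        rw [lintegral_finsetSum]
        · exact Finset.sum_congr rfl fun i _ => (key i).symm
        · exact fun i _ => (hI.comp (measurable_pi_apply i)).mul (hN _).inv
    _ ≤ ∫⁻ _, 1 ∂(Measure.pi fun _ : Fin (m + 1) => Q) :=
        lintegral_mono fun z => ENNReal.mul_inv_le_one _
    _ = 1 := by simp

/-! ### Error of a node average given the covariates -/

/-- The Bochner integral of a non-integrable function is zero, so a positive value of `∫ e²` already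
forces square integrability. -/
lemma IsErrorLaw.memLp_id {ν : Measure ℝ} {σsq : ℝ} (h : IsErrorLaw ν σsq) :
    MemLp (fun e : ℝ => e) 2 ν := by
  refine (memLp_two_iff_integrable_sq measurable_id.aestronglyMeasurable).2 ?_
  by_contra hcon
  exact h.variance_pos.ne ((integral_undef hcon).symm.trans h.variance_eq)

lemma IsErrorLaw.lintegral_sq_sum_mul {ν : Measure ℝ} {σsq : ℝ} (h : IsErrorLaw ν σsq) {m : ℕ}
    (w : Fin m → ℝ) :
    ∫⁻ e, ENNReal.ofReal ((∑ i, w i * e i) ^ 2) ∂(Measure.pi fun _ : Fin m => ν)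
      = ENNReal.ofReal (σsq * ∑ i, w i ^ 2) := by
  have := h.isProbabilityMeasure
  have hL (i : Fin m) : MemLp (fun e : ℝ => w i * e) 2 ν := h.memLp_id.const_mul (w i)
  have hLpi (i : Fin m) : MemLp (fun e : Fin m → ℝ => w i * e i) 2
      (Measure.pi fun _ : Fin m => ν) :=
    (hL i).comp_measurePreserving (measurePreserving_eval (fun _ : Fin m => ν) i)
  have hvar := variance_sum_pi (μ := fun _ : Fin m => ν) (X := fun i e => w i * e) hL
  have hsum : (∑ i, fun e : Fin m → ℝ => w i * e i) = fun e => ∑ i, w i * e i := by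
    ext; simp
  have hmean : ∫ e, (∑ i, w i * e i) ∂(Measure.pi fun _ : Fin m => ν) = 0 := by
    rw [integral_finsetSum _ fun i _ => (hLpi i).integrable (by norm_num)]
    refine Finset.sum_eq_zero fun i _ => ?_
    rw [integral_const_mul, integral_comp_eval (μ := fun _ : Fin m => ν) (i := i)
      (f := fun e : ℝ => e) measurable_id.aestronglyMeasurable, h.mean_zero, mul_zero]
  rw [hsum] at hvar
  have hS : MemLp (fun e : Fin m → ℝ => ∑ i, w i * e i) 2 (Measure.pi fun _ : Fin m => ν) :=
    memLp_finsetSum _ fun i _ => hLpi i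
  have h1 := ofReal_variance hS
  rw [evariance_eq_lintegral_ofReal, hmean, hvar] at h1
  simp only [sub_zero] at h1
  rw [← h1]
  congr 1
  rw [Finset.mul_sum]
  refine Finset.sum_congr rfl fun i _ => ?_
  rw [variance_const_mul, variance_of_integral_eq_zero (X := fun e : ℝ => e) measurable_id.aemeasurable
      h.mean_zero,
    h.variance_eq, mul_comm]

lemma ofReal_localSize {p m : ℕ} (D : Dataset p m) (t : Set (Fin p → ℝ)) :
    ENNReal.ofReal (localSize D t) = ∑ i, t.indicator (fun _ => (1 : ℝ≥0∞)) (D i).1 := by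
  unfold localSize
  rw [ENNReal.ofReal_sum_of_nonneg fun i _ => Set.indicator_nonneg (fun _ _ => zero_le_one) _]
  refine Finset.sum_congr rfl fun i _ => ?_
  by_cases h : (D i).1 ∈ t <;> simp [h]

/-- Conditionally on the covariates, the squared error of a node average is at most
`(2σ² + c²) / (1 + N)`, where `N` is the number of observations in the node. -/
lemma IsErrorLaw.lintegral_sq_cartEstimate_sub_le {ν : Measure ℝ} {σsq : ℝ}
    (h : IsErrorLaw ν σsq) (c : ℝ) {p m : ℕ} (T : DTree p) (x : Fin p → ℝ)
    (z : Fin m → Fin p → ℝ) :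
    ∫⁻ e, ENNReal.ofReal ((cartEstimate T (fun i => (z i, c + e i)) x - c) ^ 2)
        ∂(Measure.pi fun _ : Fin m => ν)
      ≤ ENNReal.ofReal (2 * σsq + c ^ 2) *
        (1 + ∑ i, (T.cell x).indicator (fun _ => (1 : ℝ≥0∞)) (z i))⁻¹ := by
  have := h.isProbabilityMeasure
  have hσ := h.variance_pos
  set A := T.cell x with hA
  set N : ℝ := ∑ i, A.indicator (fun _ => (1 : ℝ)) (z i) with hN
  have hsize (e : Fin m → ℝ) : localSize (fun i => (z i, c + e i)) A = N := rfl
  have hNE : ∑ i, A.indicator (fun _ => (1 : ℝ≥0∞)) (z i) = ENNReal.ofReal N := by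
    rw [← hsize 0, ofReal_localSize]
  have hN0 : 0 ≤ N := Finset.sum_nonneg fun i _ => Set.indicator_nonneg (fun _ _ => zero_le_one) _
  have hrhs : ENNReal.ofReal (2 * σsq + c ^ 2) * (1 + ENNReal.ofReal N)⁻¹
      = ENNReal.ofReal ((2 * σsq + c ^ 2) / (1 + N)) := by
    rw [← ENNReal.ofReal_one, ← ENNReal.ofReal_add zero_le_one hN0,
      ENNReal.ofReal_div_of_pos (by positivity), div_eq_mul_inv]
  rw [hNE, hrhs]
  by_cases h0 : N = 0
  · have : ∀ e : Fin m → ℝ, cartEstimate T (fun i => (z i, c + e i)) x - c = -c := by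
      intro e
      simp [cartEstimate, ← hA, hsize, h0]
    simp_rw [this]
    simp only [even_two, Even.neg_pow, lintegral_const, measure_univ, mul_one, h0, add_zero,
      div_one]
    exact ENNReal.ofReal_le_ofReal (by linarith)
  · have hN1 : 1 ≤ N := by
      classical
      have hcard : N = ((Finset.univ.filter fun i => z i ∈ A).card : ℝ) := by
        simp [hN, Set.indicator_apply]
      rw [hcard] at h0 ⊢
      exact_mod_cast Nat.one_le_iff_ne_zero.2 (by exact_mod_cast h0)
    have hsum : ∀ e : Fin m → ℝ, cartEstimate T (fun i => (z i, c + e i)) x - c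
        = ∑ i, (A.indicator (fun _ => (1 : ℝ)) (z i) / N) * e i := by
      intro e
      have h1 : ∑ i, A.indicator (fun _ => c + e i) (z i)
          = N * c + ∑ i, A.indicator (fun _ => (1 : ℝ)) (z i) * e i := by
        rw [hN, Finset.sum_mul, ← Finset.sum_add_distrib]
        refine Finset.sum_congr rfl fun i _ => ?_
        by_cases hi : z i ∈ A <;> simp [hi]
      simp only [cartEstimate, ← hA, hsize, h0, if_false]
      rw [h1, mul_add, ← mul_assoc, one_div_mul_cancel h0, one_mul, add_sub_cancel_left,
        Finset.mul_sum]
      exact Finset.sum_congr rfl fun i _ => by ring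
    simp_rw [hsum]
    rw [h.lintegral_sq_sum_mul]
    refine ENNReal.ofReal_le_ofReal ?_
    have h2 : ∑ i, (A.indicator (fun _ => (1 : ℝ)) (z i) / N) ^ 2 = 1 / N := by
      have : ∀ i, (A.indicator (fun _ => (1 : ℝ)) (z i) / N) ^ 2
          = A.indicator (fun _ => (1 : ℝ)) (z i) / N ^ 2 := by
        intro i
        by_cases hi : z i ∈ A <;> simp [hi]
      simp_rw [this]
      rw [← Finset.sum_div, ← hN]
      field_simp
    rw [h2, mul_one_div, div_le_div_iff₀ (by linarith) (by linarith)]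
    nlinarith [sq_nonneg c, mul_nonneg (sq_nonneg c) hN0]

/-! ### Risk over a fixed tree -/

/-- Trees carry no σ-algebra, so measurability passes through the relation of sharing a cell. The
parameter space `β` is the space of tree samples, or `Unit` for a fixed tree. -/
lemma measurable_cartEstimate {β : Type*} [MeasurableSpace β] {p m : ℕ} {T : β → DTree p}
    (hT : MeasurableSet {q : β × (Fin p → ℝ) × (Fin p → ℝ) | q.2.2 ∈ (T q.1).cell q.2.1}) :
    Measurable fun q : β × Dataset p m × (Fin p → ℝ) => cartEstimate (T q.1) q.2.1 q.2.2 := by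
  have hset (i : Fin m) : MeasurableSet {q : β × Dataset p m × (Fin p → ℝ) |
      (q.2.1 i).1 ∈ (T q.1).cell q.2.2} :=
    (show Measurable fun q : β × Dataset p m × (Fin p → ℝ) => (q.1, q.2.2, (q.2.1 i).1)
      by fun_prop) hT
  have hind {g : β × Dataset p m × (Fin p → ℝ) → ℝ} (i : Fin m) (hg : Measurable g) :
      Measurable fun q : β × Dataset p m × (Fin p → ℝ) =>
        ((T q.1).cell q.2.2).indicator (fun _ => g q) (q.2.1 i).1 := by
    classical
    exact Measurable.ite (hset i) hg measurable_const
  have hsize : Measurable fun q : β × Dataset p m × (Fin p → ℝ) =>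
      localSize q.2.1 ((T q.1).cell q.2.2) :=
    Finset.measurable_sum _ fun i _ => hind i measurable_const
  refine Measurable.ite (hsize (measurableSet_singleton 0)) measurable_const
    ((hsize.const_div 1).mul (Finset.measurable_sum _ fun i _ => hind i ?_))
  fun_prop

/-- The mean integrated squared error of node averages over a fixed tree. -/
lemma IsErrorLaw.lintegral_risk_le {ν : Measure ℝ} {σsq : ℝ} (h : IsErrorLaw ν σsq) (c : ℝ)
    {p m : ℕ} (T : DTree p) (hT : MeasurableSet {q : (Fin p → ℝ) × (Fin p → ℝ) | q.2 ∈ T.cell q.1})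
    (Q : Measure (Fin p → ℝ)) [IsProbabilityMeasure Q] :
    ∫⁻ v, ∫⁻ x, ENNReal.ofReal ((cartEstimate T (fun i => ((v i).1, c + (v i).2)) x - c) ^ 2) ∂Q
        ∂(Measure.pi fun _ : Fin m => Q.prod ν)
      ≤ ENNReal.ofReal (2 * σsq + c ^ 2) * ((m + 1 : ℝ≥0∞)⁻¹ * 2 ^ T.depth) := by
  have := h.isProbabilityMeasure
  have hm : Measurable fun q : (Fin m → (Fin p → ℝ) × ℝ) × (Fin p → ℝ) =>
      ENNReal.ofReal ((cartEstimate T (fun i => ((q.1 i).1, c + (q.1 i).2)) q.2 - c) ^ 2) := by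
    have hc := measurable_cartEstimate (m := m) (T := fun _ : Unit => T)
      (hT.preimage measurable_snd)
    have hq : Measurable fun q : (Fin m → (Fin p → ℝ) × ℝ) × (Fin p → ℝ) =>
        (((), (fun i => ((q.1 i).1, c + (q.1 i).2)), q.2) : Unit × Dataset p m × (Fin p → ℝ)) := by
      fun_prop
    exact (((hc.comp hq).sub_const c).pow_const 2).ennreal_ofReal
  rw [lintegral_lintegral_swap hm.aemeasurable]
  have hx (x : Fin p → ℝ) :
      ∫⁻ v, ENNReal.ofReal ((cartEstimate T (fun i => ((v i).1, c + (v i).2)) x - c) ^ 2)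
        ∂(Measure.pi fun _ : Fin m => Q.prod ν)
      ≤ ENNReal.ofReal (2 * σsq + c ^ 2) * ((m + 1 : ℝ≥0∞)⁻¹ * (Q (T.cell x))⁻¹) := by
    -- Separating covariates from errors lets the errors be integrated out first.
    have hmp : MeasurePreserving
        (fun v : Fin m → (Fin p → ℝ) × ℝ => ((fun i => (v i).1), fun i => (v i).2))
        (Measure.pi fun _ => Q.prod ν) ((Measure.pi fun _ => Q).prod (Measure.pi fun _ => ν)) :=
      measurePreserving_arrowProdEquivProdArrow (Fin p → ℝ) ℝ (Fin m) (fun _ => Q) (fun _ => ν)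
    have hyx : Measurable fun y : (Fin m → Fin p → ℝ) × (Fin m → ℝ) =>
        (((fun i => (y.1 i, y.2 i)), x) : (Fin m → (Fin p → ℝ) × ℝ) × (Fin p → ℝ)) := by
      fun_prop
    have hmx : Measurable fun y : (Fin m → Fin p → ℝ) × (Fin m → ℝ) =>
        ENNReal.ofReal ((cartEstimate T (fun i => (y.1 i, c + y.2 i)) x - c) ^ 2) := by
      have hcomp := hm.comp hyx
      simpa only [Function.comp_def] using hcomp
    refine (hmp.lintegral_comp hmx).trans_le ?_
    rw [lintegral_prod _ hmx.aemeasurable]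
    refine (lintegral_mono fun z => h.lintegral_sq_cartEstimate_sub_le c T x z).trans ?_
    rw [lintegral_const_mul' _ _ ENNReal.ofReal_ne_top]
    gcongr
    refine (lintegral_inv_one_add_card_le Q (T.measurableSet_cell x) m).trans_eq ?_
    rw [ENNReal.mul_inv] <;> simp
  refine (lintegral_mono hx).trans ?_
  rw [lintegral_const_mul' _ _ ENNReal.ofReal_ne_top,
    lintegral_const_mul' _ _ (by simp)]
  gcongr
  simpa using T.lintegral_inv_measure_cell_le Q MeasurableSet.univ

/-! ### The honest experiment -/

namespace HonestExperiment

variable {ρ c : ℝ} {ν : Measure ℝ} {n : ℕ} (E : HonestExperiment.{u} ρ c ν n)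

lemma outcome_eq (i : Fin n) (ω : E.Ω) : E.Y i ω = c + E.ε i ω := by
  rw [E.model.outcome_eq, E.model.regression_const _ (E.model.mem_support i ω)]

lemma measurable_outcome (i : Fin n) : Measurable (E.Y i) := by
  rw [funext (E.outcome_eq i)]
  exact (E.model.measurable_ε i).const_add c

lemma treeSample_eq (ω : E.Ω) : E.treeSample ω =
    fun k => (E.X (E.split (Sum.inl k)) ω, c + E.ε (E.split (Sum.inl k)) ω) :=
  funext fun _ => Prod.ext rfl (E.outcome_eq _ ω)

lemma estSample_eq (ω : E.Ω) : E.estSample ω =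
    fun k => (E.X (E.split (Sum.inr k)) ω, c + E.ε (E.split (Sum.inr k)) ω) :=
  funext fun _ => Prod.ext rfl (E.outcome_eq _ ω)

lemma integratedSqError_eq (ω : E.Ω) :
    E.integratedSqError ω =
      ∫⁻ x in E.𝒳, ENNReal.ofReal ((E.honestEstimate ω x - c) ^ 2) ∂E.PX :=
  setLIntegral_congr_fun E.model.measurableSet_support fun x hx => by
    simp only [E.model.regression_const x hx]

lemma isProbabilityMeasure_PX (hn : 0 < n) : IsProbabilityMeasure E.PX := by
  rw [← E.model.law_X ⟨0, hn⟩]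
  exact Measure.isProbabilityMeasure_map (E.model.measurable_X _).aemeasurable

lemma measurable_integratedSqError (hn : 0 < n) : Measurable E.integratedSqError := by
  have := E.isProbabilityMeasure_PX hn
  have hX := E.model.measurable_X
  have hY := E.measurable_outcome
  have hc := measurable_cartEstimate (m := E.nμ) E.isCARTProcedure.measurable_cell
  have hq : Measurable fun q : E.Ω × (Fin E.p → ℝ) =>
      (E.treeSample q.1, E.estSample q.1, q.2) := by
    unfold treeSample estSample
    fun_prop
  rw [funext E.integratedSqError_eq]
  exact (((hc.comp hq).sub_const c).pow_const 2).ennreal_ofReal.lintegral_prod_right'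

/-- The tree sample and the estimation sample, with errors in place of responses, are independent
samples from `PX ⊗ ν`. -/
lemma map_samples (hn : 0 < n) :
    E.P.map (fun ω => ((fun k => (E.X (E.split (Sum.inl k)) ω, E.ε (E.split (Sum.inl k)) ω)),
      fun k => (E.X (E.split (Sum.inr k)) ω, E.ε (E.split (Sum.inr k)) ω)))
    = (Measure.pi fun _ : Fin E.nT => E.PX.prod ν).prod
        (Measure.pi fun _ : Fin E.nμ => E.PX.prod ν) := by
  have := E.isProbabilityMeasure_PX hn
  have hX := E.model.measurable_X
  have hε := E.model.measurable_ε
  have : IsProbabilityMeasure ν := by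
    rw [← E.model.law_ε ⟨0, hn⟩]
    exact Measure.isProbabilityMeasure_map (hε _).aemeasurable
  have hind : iIndepFun (fun i ω => (E.X i ω, E.ε i ω)) E.P := by
    -- Independence is assumed for the pairs `(X, Y)`; subtracting `c` from the response recovers
    -- the error.
    have h1 := E.model.indep_sample.comp (fun _ q => (q.1, q.2 - c)) fun _ => by fun_prop
    refine (iIndepFun_congr fun i => ?_).1 h1
    filter_upwards with ω
    simp [E.outcome_eq]
  have hlaw (i : Fin n) : E.P.map (fun ω => (E.X i ω, E.ε i ω)) = E.PX.prod ν := by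
    rw [(indepFun_iff_map_prod_eq_prod_map_map (hX i).aemeasurable (hε i).aemeasurable).1
      (E.model.indep_X_ε i), E.model.law_X, E.model.law_ε]
  have hpi := (iIndepFun_iff_map_fun_eq_pi_map fun s => by fun_prop).1
    (hind.precomp E.split.injective)
  simp only [hlaw] at hpi
  have hmp := measurePreserving_sumPiEquivProdPi
    (fun _ : Fin E.nT ⊕ Fin E.nμ => E.PX.prod ν)
  rw [← hmp.map_eq, ← hpi, Measure.map_map hmp.measurable (by fun_prop)]
  rfl

lemma lintegral_integratedSqError_le (hn : 0 < n) {σsq : ℝ} (h : IsErrorLaw ν σsq) :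
    ∫⁻ ω, E.integratedSqError ω ∂E.P
      ≤ ENNReal.ofReal (2 * σsq + c ^ 2) * ((E.nμ + 1 : ℝ≥0∞)⁻¹ * 2 ^ E.K) := by
  have := E.isProbabilityMeasure_PX hn
  have := h.isProbabilityMeasure
  have hX := E.model.measurable_X
  have hε := E.model.measurable_ε
  set Ψ : (Dataset E.p E.nT) × (Dataset E.p E.nμ) → ℝ≥0∞ := fun q =>
    ∫⁻ x, ENNReal.ofReal ((cartEstimate (E.tree fun i => ((q.1 i).1, c + (q.1 i).2))
      (fun i => ((q.2 i).1, c + (q.2 i).2)) x - c) ^ 2) ∂E.PX with hΨ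
  have hΨm : Measurable Ψ := by
    have hc := measurable_cartEstimate (m := E.nμ) E.isCARTProcedure.measurable_cell
    have hq : Measurable fun q : ((Dataset E.p E.nT) × (Dataset E.p E.nμ)) × (Fin E.p → ℝ) =>
        (((fun i => ((q.1.1 i).1, c + (q.1.1 i).2)), (fun i => ((q.1.2 i).1, c + (q.1.2 i).2)),
          q.2) : Dataset E.p E.nT × Dataset E.p E.nμ × (Fin E.p → ℝ)) := by
      fun_prop
    exact (((hc.comp hq).sub_const c).pow_const 2).ennreal_ofReal.lintegral_prod_right'
  have hle (ω : E.Ω) : E.integratedSqError ω ≤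
      Ψ ((fun k => (E.X (E.split (Sum.inl k)) ω, E.ε (E.split (Sum.inl k)) ω)),
        fun k => (E.X (E.split (Sum.inr k)) ω, E.ε (E.split (Sum.inr k)) ω)) := by
    rw [E.integratedSqError_eq, hΨ]
    refine (setLIntegral_le_lintegral _ _).trans_eq ?_
    simp only [honestEstimate, E.treeSample_eq, E.estSample_eq]
  refine (lintegral_mono hle).trans ?_
  -- Honesty enters here: under the product law the estimation sample is integrated with the tree
  -- sample frozen.
  rw [← lintegral_map (f := Ψ) hΨm (by fun_prop), E.map_samples hn,
    lintegral_prod _ hΨm.aemeasurable]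
  calc _ ≤ ∫⁻ _, ENNReal.ofReal (2 * σsq + c ^ 2) * ((E.nμ + 1 : ℝ≥0∞)⁻¹ * 2 ^ E.K)
        ∂(Measure.pi fun _ : Fin E.nT => E.PX.prod ν) := by
        refine lintegral_mono fun u => ?_
        refine (h.lintegral_risk_le c (E.tree fun i => ((u i).1, c + (u i).2))
          (E.isCARTProcedure.measurable_cell.preimage measurable_prodMk_left) E.PX).trans ?_
        gcongr
        · norm_num
        · exact E.isCARTProcedure.depth_le _
    _ = _ := by simp

lemma sample_size_le (hρ : 1 ≤ ρ) : (n : ℝ) ≤ (1 + ρ) * E.nμ := by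
  have hcard : E.nT + E.nμ = n := by simpa using Fintype.card_congr E.split
  have hpos : 0 < (E.nT : ℝ) / E.nμ :=
    (inv_pos.2 (zero_lt_one.trans_le hρ)).trans_le E.ratio_lower
  have hμ : 0 < (E.nμ : ℝ) := by
    -- Division by zero gives zero, so the positive lower bound on the ratio excludes an empty
    -- estimation sample.
    rcases Nat.eq_zero_or_pos E.nμ with h0 | h0
    · simp [h0] at hpos
    · exact_mod_cast h0
  have hup := (div_le_iff₀ hμ).1 E.ratio_upper
  have : (n : ℝ) = E.nT + E.nμ := by exact_mod_cast hcard.symm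
  linarith

/-- The mean integrated squared error is of the order `2^K / n`. -/
lemma lintegral_integratedSqError_le_ofReal (hρ : 1 ≤ ρ) (hn : 0 < n) {σsq : ℝ}
    (h : IsErrorLaw ν σsq) :
    ∫⁻ ω, E.integratedSqError ω ∂E.P
      ≤ ENNReal.ofReal ((2 * σsq + c ^ 2) * (1 + ρ) * (2 ^ E.K / n)) := by
  have hσ := h.variance_pos
  have hn' : (0 : ℝ) < n := by exact_mod_cast hn
  have hsize := E.sample_size_le hρ
  refine (E.lintegral_integratedSqError_le hn h).trans ?_
  have h1 : (E.nμ + 1 : ℝ≥0∞)⁻¹ = ENNReal.ofReal ((E.nμ + 1 : ℝ)⁻¹) := by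
    rw [ENNReal.ofReal_inv_of_pos (by positivity), ENNReal.ofReal_add (by positivity) zero_le_one]
    simp
  have h2 : (2 : ℝ≥0∞) ^ E.K = ENNReal.ofReal (2 ^ E.K) := by
    rw [ENNReal.ofReal_pow zero_le_two]
    simp
  rw [h1, h2, ← ENNReal.ofReal_mul (by positivity), ← ENNReal.ofReal_mul (by positivity),
    mul_assoc (2 * σsq + c ^ 2)]
  refine ENNReal.ofReal_le_ofReal (mul_le_mul_of_nonneg_left ?_ (by positivity))
  rw [inv_mul_eq_div, mul_div_assoc', div_le_div_iff₀ (by positivity) hn']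
  have : (0 : ℝ) < 2 ^ E.K := by positivity
  nlinarith

lemma lintegral_integratedSqError_le_rate (hρ : 1 ≤ ρ) (hn : 0 < n) {σsq : ℝ}
    (h : IsErrorLaw ν σsq) {C : ℝ}
    (hC : (2 * σsq + c ^ 2) * (1 + ρ) ≤ C * Real.log n ^ 5) :
    ∫⁻ ω, E.integratedSqError ω ∂E.P ≤ ENNReal.ofReal (C * E.rate) := by
  refine (E.lintegral_integratedSqError_le_ofReal hρ hn h).trans (ENNReal.ofReal_le_ofReal ?_)
  have hr : C * E.rate = C * Real.log n ^ 5 * (2 ^ E.K / n) := by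
    unfold rate
    ring
  rw [hr]
  exact mul_le_mul_of_nonneg_right hC (by positivity)

end HonestExperiment

lemma tendsto_log_natCast_pow_five : Tendsto (fun n : ℕ => Real.log n ^ 5) atTop atTop :=
  (tendsto_pow_atTop (by norm_num)).comp (Real.tendsto_log_atTop.comp tendsto_natCast_atTop_atTop)

theorem mainTheorem6 (ρ : ℝ) (hρ : 1 ≤ ρ) :
    -- mean bound with a constant that depends only on the error variance and on `ρ`
    (∀ σsq : ℝ, 0 < σsq → ∃ C : ℝ, 0 < C ∧ ∀ c : ℝ, ∃ n₀ : ℕ, ∀ n : ℕ, n₀ ≤ n →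
      ∀ ν : Measure ℝ, IsErrorLaw ν σsq → ∀ E : HonestExperiment.{u} ρ c ν n,
        ∫⁻ ω, E.integratedSqError ω ∂E.P ≤ ENNReal.ofReal (C * E.rate)) ∧
    -- mean bound for every sample size, with a constant that may also depend on `c`
    (∀ σsq : ℝ, 0 < σsq → ∀ c : ℝ, ∃ C : ℝ, 0 < C ∧ ∀ n : ℕ, 2 ≤ n →
      ∀ ν : Measure ℝ, IsErrorLaw ν σsq → ∀ E : HonestExperiment.{u} ρ c ν n,
        ∫⁻ ω, E.integratedSqError ω ∂E.P ≤ ENNReal.ofReal (C * E.rate)) ∧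
    -- bound in probability with a constant that depends only on `ρ` and on the error law
    (∀ (σsq : ℝ) (ν : Measure ℝ), IsErrorLaw ν σsq → ∃ C' : ℝ, 0 < C' ∧
      ∀ (c : ℝ) (N : ℕ → ℕ), Tendsto N atTop atTop →
      ∀ E : (k : ℕ) → HonestExperiment.{u} ρ c ν (N k),
        limsup (fun k => (E k).P
          {ω | ENNReal.ofReal (C' * (E k).rate) ≤ (E k).integratedSqError ω}) atTop = 0) := by

  have hρ0 : 0 < 1 + ρ := by linarith
  refine ⟨fun σsq hσ => ⟨1, one_pos, fun c => ?_⟩, fun σsq hσ c => ?_, fun σsq ν hν => ?_⟩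
  · obtain ⟨n₀, h₀⟩ := eventually_atTop.1
      ((tendsto_log_natCast_pow_five.eventually_ge_atTop ((2 * σsq + c ^ 2) * (1 + ρ))).and
        (eventually_ge_atTop 1))
    refine ⟨n₀, fun n hn ν hν E => ?_⟩
    exact E.lintegral_integratedSqError_le_rate hρ (h₀ n hn).2 hν (by simpa using (h₀ n hn).1)
  · have hlog : 0 < Real.log 2 ^ 5 := by positivity
    refine ⟨(2 * σsq + c ^ 2) * (1 + ρ) / Real.log 2 ^ 5, by positivity, fun n hn ν hν E => ?_⟩
    refine E.lintegral_integratedSqError_le_rate hρ (by omega) hν ?_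
    rw [div_mul_eq_mul_div, le_div_iff₀ hlog]
    have : Real.log 2 ≤ Real.log n :=
      Real.log_le_log two_pos (by exact_mod_cast hn)
    gcongr
  · refine ⟨1, one_pos, fun c N hN E => Tendsto.limsup_eq ?_⟩
    have hσ := hν.variance_pos
    have hlog := tendsto_log_natCast_pow_five.comp hN
    have hlim : Tendsto (fun k => ENNReal.ofReal
        ((2 * σsq + c ^ 2) * (1 + ρ) / Real.log (N k) ^ 5)) atTop (𝓝 0) := by
      rw [← ENNReal.ofReal_zero]
      exact ENNReal.tendsto_ofReal (hlog.const_div_atTop _)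
    refine tendsto_of_tendsto_of_tendsto_of_le_of_le' tendsto_const_nhds hlim
      (Eventually.of_forall fun _ => zero_le) ?_
    filter_upwards [hlog.eventually_gt_atTop 0, hN.eventually_ge_atTop 1] with k hk hNk
    have hk' : 0 < Real.log (N k) ^ 5 := hk
    have hNpos : (0 : ℝ) < N k := by exact_mod_cast hNk
    have hrate : 0 < (E k).rate := by
      unfold HonestExperiment.rate
      positivity
    rw [one_mul]
    refine (meas_ge_le_lintegral_div ((E k).measurable_integratedSqError hNk).aemeasurable
      (by simpa using hrate) ENNReal.ofReal_ne_top).trans ?_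
    refine ENNReal.div_le_of_le_mul ?_
    rw [← ENNReal.ofReal_mul (by positivity)]
    exact (E k).lintegral_integratedSqError_le_rate hρ hNk hν
      (div_mul_cancel₀ _ hk'.ne').ge
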